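/- Let $d\ge 2$, let $\mathcal P_d$ be the set of probability vectors on $\{1,\dots,d\}$, let $p_0\in\mathcal P_d$, $n\ge 1$, $\alpha\in(0,1]$ and $\gamma\in(0,1)$. A sequentially interactive privacy mechanism $Q$ consists of a measurable space $\mathcal Z$ and, for $i=1,\dots,n$, Markov kernels $Q_i(\cdot\mid x,z_1,\dots,z_{i-1})$ on $\mathcal Z$, where $x\in\{1,\dots,d\}$ and $z_1,\dots,z_{i-1}\in\mathcal Z$; given data $X_1,\dots,X_n\overset{\mathrm{i.i.d.}}{\sim}p$, the private datum $Z_i$ is drawn from $Q_i(\cdot\mid X_i,Z_1,\dots,Z_{i-1})$. It is $\alpha$-LDP, written $Q\in\mathcal Q_\alpha$, if $$Q_i(A\mid x,z_1,\dots,z_{i-1})\le e^{\alpha}\,Q_i(A\mid x',z_1,\dots,z_{i-1})$$ for all $i$, all measurable $A$, all $x,x'$ and all $z_1,\dots,z_{i-1}$. For $r\in\{1,2\}$ and $\delta>0$ put $H_1(\delta,\mathbb L_r)=\{p\in\mathcal P_d:\|p-p_0\|_r\ge\delta\}$, $$\mathcal R_{n,\alpha}(p_0,\delta,\mathbb L_r)=\inf_{Q\in\mathcal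 Q_\alpha}\ \inf_{\phi:\mathcal Z^n\to[0,1]}\ \sup_{p\in H_1(\delta,\mathbb L_r)}\bigl\{\mathbb E_{p_0}\phi(Z_1,\dots,Z_n)+\mathbb E_p\bigl(1-\phi(Z_1,\dots,Z_n)\bigr)\bigr\}$$ (the supremum over the empty set being $0$, and $\phi$ ranging over measurable functions), and let $$\mathcal E_{n,\alpha}(p_0,\mathbb L_r)=\inf\{\delta>0:\mathcal R_{n,\alpha}(p_0,\delta,\mathbb L_r)\le\gamma\}$$ be the $\alpha$-LDP minimax testing radius. There exist $c_1=c_1(\gamma)>0$ and $c_2=c_2(\gamma)>0$ such that for all $d\ge2$, $p_0\in\mathcal P_d$, $n\ge1$ and $\alpha\in(0,1]$: if $p_0(1)\ge p_0(2)\ge\dots\ge p_0(d)$, then $$\mathcal E_{n,\alpha}(p_0,\mathbb L_1)\ \ge\ c_1\max_{j=1,\dots,d}\min\Bigl\{\frac{j^{1/2}}{(n\alpha^2)^{1/2}},\ \frac{p_0(j)}{\log^{1/2}(2j)}\Bigr\},$$ and, whether or not $p_0$ is so ordered, $$\mathcal E_{n,\alpha}(p_0,\mathbb L_2)\ \ge\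 c_2\min\Bigl\{1,\ \frac{1}{(n\alpha^2)^{1/2}}\Bigr\},$$ so that $\mathcal E_{n,\alpha}(p_0,\mathbb L_2)\ge c_2/(n\alpha^2)^{1/2}$ whenever $n\alpha^2\ge1$. In particular, there exists $c_1=c_1(\gamma)>0$ such that, for all $d\ge2$, all $p_0\in\mathcal P_d$ with $p_0(1)\ge\dots\ge p_0(d)$, all $n\ge1$ and all $\alpha\in(0,1]$, $$\mathcal E_{n,\alpha}(p_0,\mathbb L_1)\ \ge\ c_1\,\frac{\tilde\ell^{1/2}}{(n\alpha^2)^{1/2}},\qquad \tilde\ell=\max\Bigl\{j\in\{1,\dots,d\}:\frac{j^{1/2}}{(n\alpha^2)^{1/2}}\le\frac{p_0(j)}{\log^{1/2}(2j)}\Bigr\},$$ whenever the set defining $\tilde\ell$ is non-empty. -/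

import Mathlib

open MeasureTheory ProbabilityTheory
open scoped ENNReal

universe u

namespace LocalPrivacy

/-- A sequentially interactive privacy mechanism for `n` data points with values in `Fin d`, with
private data in `Z`: `channel i x z` is the conditional law `Q_i(· | x, z_1, …, z_{i-1})` of the
private datum of the `i`-th individual, given that their own datum is `x` and that the private data
released before are `z`. -/
structure Mechanism (n d : ℕ) (Z : Type u) [MeasurableSpace Z] where
  channel : (i : Fin n) → Fin d → Kernel (Fin (i : ℕ) → Z) Z
  markov : ∀ (i : Fin n) (x : Fin d), IsMarkovKernel (channel i x)

namespace Mechanism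

variable {n d : ℕ} {Z : Type u} [MeasurableSpace Z]

/-- `α`-local differential privacy:
`Q_i(A | x, z_1, …, z_{i-1}) ≤ e ^ α * Q_i(A | x', z_1, …, z_{i-1})`. -/
def IsLDP (Q : Mechanism n d Z) (α : ℝ) : Prop :=
  ∀ (i : Fin n) (x x' : Fin d) (z : Fin (i : ℕ) → Z) (A : Set Z), MeasurableSet A →
    Q.channel i x z A ≤ ENNReal.ofReal (Real.exp α) * Q.channel i x' z A

/-- The joint law of the first `k` private data `Z_1, …, Z_k`, given the data `X_1, …, X_k`. -/
noncomputable def condLaw (Q : Mechanism n d Z) :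
    (k : ℕ) → k ≤ n → (Fin k → Fin d) → Measure (Fin k → Z)
  | 0, _, _ => Measure.dirac (fun i => i.elim0)
  | k + 1, hk, x =>
      ((Q.condLaw k (Nat.le_of_succ_le hk) (fun i => x i.castSucc)) ⊗ₘ
        (Q.channel ⟨k, hk⟩ (x (Fin.last k)))).map
          (fun w => (Fin.snoc w.1 w.2 : Fin (k + 1) → Z))

/-- The law of the private data `Z_1, …, Z_n` when `X_1, …, X_n` are i.i.d. with distribution `p`
(a probability vector). -/
noncomputable def law (Q : Mechanism n d Z) (p : Fin d → ℝ) : Measure (Fin n → Z) :=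
  ∑ x : Fin n → Fin d, ENNReal.ofReal (∏ i, p (x i)) • Q.condLaw n le_rfl x

end Mechanism

/-- The alternative `H_1(δ, L_r)`: the probability vectors `p` with `‖p - p₀‖_r ≥ δ`. -/
def alternative {d : ℕ} (p₀ : Fin d → ℝ) (δ : ℝ) (r : ℝ≥0∞) : Set (Fin d → ℝ) :=
  {p | p ∈ stdSimplex ℝ (Fin d) ∧ δ ≤ ‖WithLp.toLp r (p - p₀)‖}

/-- The (randomized) tests: measurable functions of the private data with values in `[0, 1]`. -/
def tests (n : ℕ) (Z : Type u) [MeasurableSpace Z] : Set ((Fin n → Z) → ℝ≥0∞) :=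
  {φ | Measurable φ ∧ ∀ z, φ z ≤ 1}

/-- The minimax testing risk when the privacy mechanism `Q` is used:
`inf_φ sup_{p ∈ H_1(δ, L_r)} {E_{p₀}(φ) + E_p(1 - φ)}`. -/
noncomputable def mechanismRisk {n d : ℕ} {Z : Type u} [MeasurableSpace Z] (Q : Mechanism n d Z)
    (p₀ : Fin d → ℝ) (δ : ℝ) (r : ℝ≥0∞) : ℝ≥0∞ :=
  ⨅ φ ∈ tests n Z, ⨆ p ∈ alternative p₀ δ r,
    ((∫⁻ z, φ z ∂(Q.law p₀)) + ∫⁻ z, (1 - φ z) ∂(Q.law p))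

/-- The `α`-LDP minimax testing risk: the infimum over all measurable spaces of private data and
all sequentially interactive `α`-LDP mechanisms. -/
noncomputable def minimaxRisk (n : ℕ) (α : ℝ) {d : ℕ} (p₀ : Fin d → ℝ) (δ : ℝ) (r : ℝ≥0∞) :
    ℝ≥0∞ :=
  ⨅ (Z : Type u) (_ : MeasurableSpace Z) (Q : Mechanism n d Z) (_ : Q.IsLDP α),
    mechanismRisk Q p₀ δ r

/-- The `α`-LDP minimax testing radius `inf {δ > 0 : R_{n,α}(p₀, δ, L_r) ≤ γ}`. -/
noncomputable def testingRadius (γ : ℝ) (n : ℕ) (α : ℝ) {d : ℕ} (p₀ : Fin d → ℝ) (r : ℝ≥0∞) : ℝ :=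
  sInf {δ : ℝ | 0 < δ ∧ minimaxRisk.{u} n α p₀ δ r ≤ ENNReal.ofReal γ}

end LocalPrivacy

namespace LocalPrivacy

open InformationTheory

/-! Lower bounds come from a finite family of alternatives `p v` that every private mechanism
confuses with `p₀` on average over `v`. By `one_le_test_errors_add_klDiv`, a test between laws of
small divergence has total error near one, and the worst case over the alternative dominates the
average over the family. The chain rule for `klDiv`, with the `p₀` law as first argument, reduces
the `n` rounds to single rounds whose past follows the `p₀` law, the same for all `v`; this handles
interactivity. In one round, privacy gives the channel outputs densities `f x` within `2 * α` of 1,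
and the chi-squared bound leaves `∑ v, (∑ x, (p v x - p₀ x) * f x) ^ 2`. Since `p v - p₀` has total
mass zero, only `f - 1` matters, whence the factor `α ^ 2`. Two families suffice. Moving mass to one
point gives the parametric rate in any norm; independent signs on pairs of points give the extra
`√j` in `L₁`, since cross terms average out. Every sign choice lies in the alternative, so no
concentration argument is needed and the logarithm only weakens the bound. -/

theorem klFun_le_sq_sub_one {x : ℝ} (hx : 0 ≤ x) : klFun x ≤ (x - 1) ^ 2 := by
  rcases hx.eq_or_lt with rfl | hx
  · simp [klFun]
  · have := mul_le_mul_of_nonneg_left (Real.log_le_sub_one_of_pos hx) hx.le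
    rw [klFun_apply]
    nlinarith

/-- A pointwise Hellinger bound: multiply `log √x ≥ 1 - 1 / √x` by `2 * x`. -/
theorem one_sub_sqrt_sq_le_klFun {x : ℝ} (hx : 0 ≤ x) : (1 - √x) ^ 2 ≤ klFun x := by
  rcases hx.eq_or_lt with rfl | hx
  · simp [klFun]
  · have hs := Real.sqrt_pos.2 hx
    have h1 := Real.one_sub_inv_le_log_of_pos hs
    have h2 := mul_le_mul_of_nonneg_left h1 hx.le
    have h3 := Real.sq_sqrt hx.le
    have h4 : x * (√x)⁻¹ = √x := by field_simp; exact h3.symm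
    rw [klFun_apply]
    rw [Real.log_sqrt hx.le] at h2
    nlinarith

/-- For `x ≤ 1`, `1 - x ≤ 2 * (1 - √x)`; AM-GM with parameter `t` and the Hellinger bound conclude.
-/
theorem one_sub_le_add_klFun_div {x t : ℝ} (hx : 0 ≤ x) (ht : 0 < t) :
    1 - x ≤ t + klFun x / t := by
  rcases le_total 1 x with h | h
  · have := div_nonneg (klFun_nonneg hx) ht.le
    linarith
  · have h1 := one_sub_sqrt_sq_le_klFun hx
    have h2 := Real.sq_sqrt hx
    have h3 := Real.sqrt_nonneg x
    have h4 : √x ≤ 1 := Real.sqrt_le_one.2 h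
    have h5 : (1 - √x) ^ 2 / t ≤ klFun x / t := by gcongr
    refine le_trans ?_ (by gcongr : t + (1 - √x) ^ 2 / t ≤ _)
    have h6 : 2 * (1 - √x) ≤ t + (1 - √x) ^ 2 / t := by
      have : 0 ≤ (t - (1 - √x)) ^ 2 / t := by positivity
      have h7 : (t - (1 - √x)) ^ 2 / t = t + (1 - √x) ^ 2 / t - 2 * (1 - √x) := by
        field_simp
        ring
      linarith
    nlinarith

/-! ### Divergence bounds and private densities -/

section Divergence

variable {Ω : Type*} [MeasurableSpace Ω]

/-- A test of two probability measures with small Kullback-Leibler divergence has a total error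
close to one. -/
theorem one_le_test_errors_add_klDiv (P T : Measure Ω) [IsProbabilityMeasure P]
    [IsProbabilityMeasure T] {φ : Ω → ℝ≥0∞} (hφ : Measurable φ) (hφ1 : ∀ z, φ z ≤ 1) {t : ℝ}
    (ht : 0 < t) :
    1 ≤ ((∫⁻ z, φ z ∂P) + ∫⁻ z, (1 - φ z) ∂T) +
      (ENNReal.ofReal t + klDiv P T / ENNReal.ofReal t) := by
  by_cases hac : P ≪ T
  swap
  · simp [klDiv_of_not_ac hac, ENNReal.top_div]
  rw [klDiv_eq_lintegral_klFun_of_ac hac, ← lintegral_rnDeriv_mul hac hφ.aemeasurable]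
  set f := P.rnDeriv T
  have hf : Measurable f := Measure.measurable_rnDeriv P T
  -- The integrand of the errors is `1 - (1 - f) * φ`, and `0 ≤ φ ≤ 1`.
  have hpt : ∀ᵐ z ∂T, (1 : ℝ≥0∞) ≤ (f z * φ z + (1 - φ z)) +
      (ENNReal.ofReal t + ENNReal.ofReal (klFun (f z).toReal) * (ENNReal.ofReal t)⁻¹) := by
    filter_upwards [P.rnDeriv_lt_top T] with z hz
    obtain ⟨a, ha⟩ : ∃ a : ℝ, a = (f z).toReal := ⟨_, rfl⟩
    obtain ⟨b, hb⟩ : ∃ b : ℝ, b = (φ z).toReal := ⟨_, rfl⟩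
    have hφt : φ z ≠ ∞ := ((hφ1 z).trans_lt ENNReal.one_lt_top).ne
    have ha0 : 0 ≤ a := ha ▸ ENNReal.toReal_nonneg
    have hb0 : 0 ≤ b := hb ▸ ENNReal.toReal_nonneg
    have hb1 : b ≤ 1 := by
      rw [hb]
      exact ENNReal.toReal_le_of_le_ofReal zero_le_one (by simpa using hφ1 z)
    have hfa : f z = ENNReal.ofReal a := by rw [ha, ENNReal.ofReal_toReal hz.ne]
    have hφb : φ z = ENNReal.ofReal b := by rw [hb, ENNReal.ofReal_toReal hφt]
    have hk := klFun_nonneg ha0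
    rw [← ha, hfa, hφb, ← ENNReal.ofReal_one, ← ENNReal.ofReal_sub _ hb0,
      ← ENNReal.ofReal_inv_of_pos ht, ← ENNReal.ofReal_mul ha0, ← ENNReal.ofReal_mul hk,
      ← ENNReal.ofReal_add (by positivity) (by linarith),
      ← ENNReal.ofReal_add ht.le (by positivity),
      ← ENNReal.ofReal_add (add_nonneg (by positivity) (by linarith)) (by positivity)]
    apply ENNReal.ofReal_le_ofReal
    have h1 := one_sub_le_add_klFun_div ha0 ht
    rw [div_eq_mul_inv] at h1
    have h2 : 0 ≤ t + klFun a * t⁻¹ := by positivity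
    nlinarith
  calc (1 : ℝ≥0∞) = ∫⁻ _, 1 ∂T := by simp
    _ ≤ _ := lintegral_mono_ae hpt
    _ = _ := by
      rw [lintegral_add_left (by fun_prop), lintegral_add_left (by fun_prop),
        lintegral_add_left (by fun_prop), lintegral_const, measure_univ, mul_one,
        lintegral_mul_const _ (by fun_prop), div_eq_mul_inv]

/-- The Kullback-Leibler divergence is at most the chi-squared divergence. -/
theorem klDiv_withDensity_le (M : Measure Ω) [IsFiniteMeasure M] {g h : Ω → ℝ}
    (hg : Measurable g) (hh : Measurable h) (hg0 : ∀ z, 0 ≤ g z) (hh0 : ∀ z, 0 < h z)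
    [IsFiniteMeasure (M.withDensity fun z => ENNReal.ofReal (g z))]
    [IsFiniteMeasure (M.withDensity fun z => ENNReal.ofReal (h z))] :
    klDiv (M.withDensity fun z => ENNReal.ofReal (g z))
        (M.withDensity fun z => ENNReal.ofReal (h z)) ≤
      ∫⁻ z, ENNReal.ofReal ((g z - h z) ^ 2 / h z) ∂M := by
  set T := M.withDensity fun z => ENNReal.ofReal (h z)
  have hP : (M.withDensity fun z => ENNReal.ofReal (g z)) =
      T.withDensity fun z => ENNReal.ofReal (g z / h z) := by
    rw [← withDensity_mul _ (by fun_prop) (by fun_prop)]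
    congr 1
    ext z
    simp only [Pi.mul_apply]
    rw [← ENNReal.ofReal_mul (hh0 z).le, mul_div_cancel₀ _ (hh0 z).ne']
  have hac : (M.withDensity fun z => ENNReal.ofReal (g z)) ≪ T := by
    rw [hP]; exact withDensity_absolutelyContinuous _ _
  rw [klDiv_eq_lintegral_klFun_of_ac hac]
  have hder : (M.withDensity fun z => ENNReal.ofReal (g z)).rnDeriv T =ᵐ[T]
      fun z => ENNReal.ofReal (g z / h z) := by
    rw [hP]; exact Measure.rnDeriv_withDensity _ (by fun_prop)
  calc _ ≤ ∫⁻ z, ENNReal.ofReal ((g z / h z - 1) ^ 2) ∂T := by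
        apply lintegral_mono_ae
        filter_upwards [hder] with z hz
        have h0 : 0 ≤ g z / h z := div_nonneg (hg0 z) (hh0 z).le
        rw [hz, ENNReal.toReal_ofReal h0]
        exact ENNReal.ofReal_le_ofReal (klFun_le_sq_sub_one h0)
    _ = _ := by
        rw [lintegral_withDensity_eq_lintegral_mul _ (by fun_prop) (by fun_prop)]
        apply lintegral_congr
        intro z
        have := hh0 z
        simp only [Pi.mul_apply]
        rw [← ENNReal.ofReal_mul this.le]
        congr 1
        field_simp

/-- Finite measures that are pairwise within a factor `e ^ α` of each other have densities,
with respect to one of them, that are uniformly close to one. -/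
theorem exists_density_near_one {ι : Type*} [Finite ι] (M : ι → Measure Ω)
    [∀ x, IsFiniteMeasure (M x)] {α : ℝ}
    (hα : 0 ≤ α) (hα1 : α ≤ 1)
    (hM : ∀ x x' A, MeasurableSet A → M x A ≤ ENNReal.ofReal (Real.exp α) * M x' A) (x₀ : ι) :
    ∃ f : ι → Ω → ℝ, (∀ x, Measurable (f x)) ∧ (∀ x z, |f x z - 1| ≤ 2 * α) ∧
      (∀ x z, Real.exp (-1) ≤ f x z) ∧
      ∀ x, M x = (M x₀).withDensity fun z => ENNReal.ofReal (f x z) := by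
  have hac : ∀ x, M x ≪ M x₀ := fun x => Measure.AbsolutelyContinuous.mk fun s hs h0 => by
    simpa [h0] using hM x x₀ s hs
  have hup : ∀ x, ∀ᵐ z ∂(M x₀), (M x).rnDeriv (M x₀) z ≤ ENNReal.ofReal (Real.exp α) := by
    intro x
    refine ae_le_of_forall_setLIntegral_le_of_sigmaFinite (Measure.measurable_rnDeriv _ _) ?_
    intro s hs _
    rw [Measure.setLIntegral_rnDeriv (hac x), setLIntegral_const]
    exact hM x x₀ s hs
  have hlo : ∀ x, ∀ᵐ z ∂(M x₀), ENNReal.ofReal (Real.exp (-α)) ≤ (M x).rnDeriv (M x₀) z := by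
    intro x
    refine ae_le_of_forall_setLIntegral_le_of_sigmaFinite measurable_const ?_
    intro s hs _
    rw [Measure.setLIntegral_rnDeriv (hac x), setLIntegral_const]
    calc _ ≤ ENNReal.ofReal (Real.exp (-α)) * (ENNReal.ofReal (Real.exp α) * M x s) := by
          gcongr; exact hM x₀ x s hs
      _ = M x s := by
          rw [← mul_assoc, ← ENNReal.ofReal_mul (Real.exp_pos _).le, ← Real.exp_add]
          simp
  have he1 : Real.exp α ≤ 1 + 2 * α := by
    have := Real.abs_exp_sub_one_le (x := α) (by rwa [abs_of_nonneg hα])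
    rw [abs_of_nonneg hα] at this
    linarith [(abs_le.1 this).2]
  have he2 : 1 - α ≤ Real.exp (-α) := by linarith [Real.add_one_le_exp (-α)]
  have he3 : Real.exp (-1) ≤ Real.exp (-α) := Real.exp_le_exp.2 (by linarith)
  have he4 : Real.exp (-α) ≤ 1 := Real.exp_le_one_iff.2 (by linarith)
  have he5 : Real.exp (-α) ≤ Real.exp α := Real.exp_le_exp.2 (by linarith)
  -- Truncating the Radon-Nikodym derivative to `[exp (-α), exp α]` makes the almost sure bounds
  -- hold at every point.
  refine ⟨fun x z => max (Real.exp (-α)) (min (Real.exp α) ((M x).rnDeriv (M x₀) z).toReal),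
    fun x => by fun_prop, fun x z => ?_, fun x z => he3.trans (le_max_left _ _), fun x => ?_⟩
  · have h1 := le_max_left (Real.exp (-α)) (min (Real.exp α) ((M x).rnDeriv (M x₀) z).toReal)
    have h2 : max (Real.exp (-α)) (min (Real.exp α) ((M x).rnDeriv (M x₀) z).toReal) ≤
      Real.exp α := max_le he5 (min_le_left _ _)
    rw [abs_le]
    constructor <;> linarith
  · conv_lhs => rw [← Measure.withDensity_rnDeriv_eq _ _ (hac x)]
    apply withDensity_congr_ae
    filter_upwards [hup x, hlo x] with z h1 h2
    have ht : (M x).rnDeriv (M x₀) z ≠ ∞ := (h1.trans_lt ENNReal.ofReal_lt_top).ne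
    rw [min_eq_right (ENNReal.toReal_le_of_le_ofReal (Real.exp_pos _).le h1),
      max_eq_right ((ENNReal.ofReal_le_iff_le_toReal ht).1 h2), ENNReal.ofReal_toReal ht]

end Divergence

/-! ### One round: mixtures of private kernels -/

/-- The mixture `∑ x, p x • κ x` of a finite family of kernels. -/
noncomputable def mixture {ι A B : Type*} [Fintype ι] [MeasurableSpace A] [MeasurableSpace B]
    (κ : ι → Kernel A B) (p : ι → ℝ) : Kernel A B where
  toFun a := ∑ x, ENNReal.ofReal (p x) • κ x a
  measurable' := by
    refine Measure.measurable_of_measurable_coe _ fun s hs => ?_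
    simp only [Measure.coe_finsetSum, Finset.sum_apply, Measure.smul_apply, smul_eq_mul]
    exact Finset.measurable_sum _ fun x _ => (Kernel.measurable_coe (κ x) hs).const_mul _

section Mixture

variable {ι A B : Type*} [Fintype ι] [MeasurableSpace A] [MeasurableSpace B]
  (κ : ι → Kernel A B)

theorem mixture_apply (p : ι → ℝ) (a : A) (s : Set B) :
    mixture κ p a s = ∑ x, ENNReal.ofReal (p x) * κ x a s := by
  simp [mixture]

variable [∀ x, IsMarkovKernel (κ x)]

theorem isMarkovKernel_mixture {p : ι → ℝ} (hp : p ∈ stdSimplex ℝ ι) :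
    IsMarkovKernel (mixture κ p) := by
  refine ⟨fun a => ⟨?_⟩⟩
  rw [mixture_apply]
  simp only [measure_univ, mul_one]
  rw [← ENNReal.ofReal_sum_of_nonneg fun x _ => hp.1 x, hp.2, ENNReal.ofReal_one]

theorem compProd_mixture (μ : Measure A) [IsFiniteMeasure μ] {p : ι → ℝ}
    (hp : p ∈ stdSimplex ℝ ι) :
    μ ⊗ₘ mixture κ p = ∑ x, ENNReal.ofReal (p x) • (μ ⊗ₘ κ x) := by
  have := isMarkovKernel_mixture κ hp
  ext s hs
  rw [Measure.compProd_apply hs]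
  simp only [mixture_apply, Measure.coe_finsetSum, Finset.sum_apply, Measure.smul_apply,
    smul_eq_mul, Measure.compProd_apply hs]
  rw [lintegral_finsetSum _ fun x _ =>
    (Kernel.measurable_kernel_prodMk_left hs).const_mul _]
  refine Finset.sum_congr rfl fun x _ => ?_
  rw [lintegral_const_mul _ (Kernel.measurable_kernel_prodMk_left hs)]

/-- The conditional divergences between mixtures of locally private kernels, summed over a finite
family of mixture weights. -/
theorem sum_klDiv_compProd_mixture_le {V : Type*} [Fintype V] (μ : Measure A)
    [IsProbabilityMeasure μ] {α : ℝ} (hα : 0 ≤ α) (hα1 : α ≤ 1)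
    (hκ : ∀ x x' a s, MeasurableSet s → κ x a s ≤ ENNReal.ofReal (Real.exp α) * κ x' a s)
    {p₀ : ι → ℝ} (hp₀ : p₀ ∈ stdSimplex ℝ ι) {p : V → ι → ℝ}
    (hp : ∀ v, p v ∈ stdSimplex ℝ ι) {b : ℝ}
    (hb : ∀ f : ι → ℝ, (∀ x, |f x - 1| ≤ 2 * α) → ∑ v, (∑ x, (p v x - p₀ x) * f x) ^ 2 ≤ b) :
    ∑ v, klDiv (μ ⊗ₘ mixture κ p₀) (μ ⊗ₘ mixture κ (p v)) ≤ ENNReal.ofReal (3 * b) := by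
  obtain ⟨x₀⟩ : Nonempty ι := by
    by_contra h
    rw [not_nonempty_iff] at h
    simpa using hp₀.2
  obtain ⟨f, hfm, hf1, hfl, hf⟩ := exists_density_near_one (fun x => μ ⊗ₘ κ x) hα hα1
    (fun x x' s hs => by
      rw [Measure.compProd_apply hs, Measure.compProd_apply hs,
        ← lintegral_const_mul _ (Kernel.measurable_kernel_prodMk_left hs)]
      exact lintegral_mono fun a => hκ x x' a _ (measurable_prodMk_left hs)) x₀
  have hfpos : ∀ x z, 0 < f x z := fun x z => (Real.exp_pos _).trans_le (hfl x z)
  set M := μ ⊗ₘ κ x₀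
  have hmix : ∀ q ∈ stdSimplex ℝ ι, μ ⊗ₘ mixture κ q =
      M.withDensity fun z => ENNReal.ofReal (∑ x, q x * f x z) := by
    intro q hq
    rw [compProd_mixture κ μ hq]
    ext s hs
    simp only [Measure.coe_finsetSum, Finset.sum_apply, Measure.smul_apply, smul_eq_mul]
    rw [withDensity_apply _ hs]
    have : ∀ z, ENNReal.ofReal (∑ x, q x * f x z) =
        ∑ x, ENNReal.ofReal (q x) * ENNReal.ofReal (f x z) := by
      intro z
      rw [ENNReal.ofReal_sum_of_nonneg fun x _ => mul_nonneg (hq.1 x) (hfpos x z).le]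
      exact Finset.sum_congr rfl fun x _ => ENNReal.ofReal_mul (hq.1 x)
    simp only [this]
    rw [lintegral_finsetSum _ fun x _ => (hfm x).ennreal_ofReal.const_mul _]
    refine Finset.sum_congr rfl fun x _ => ?_
    rw [lintegral_const_mul _ (hfm x).ennreal_ofReal, hf x, withDensity_apply _ hs]
  have hlow : ∀ q ∈ stdSimplex ℝ ι, ∀ z, Real.exp (-1) ≤ ∑ x, q x * f x z := by
    intro q hq z
    calc Real.exp (-1) = ∑ x, q x * Real.exp (-1) := by rw [← Finset.sum_mul, hq.2, one_mul]
      _ ≤ _ := Finset.sum_le_sum fun x _ => mul_le_mul_of_nonneg_left (hfl x z) (hq.1 x)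
  have hmeas : ∀ q : ι → ℝ, Measurable fun z => ∑ x, q x * f x z := fun q =>
    Finset.measurable_sum _ fun x _ => (hfm x).const_mul _
  have hstep : ∀ v, klDiv (μ ⊗ₘ mixture κ p₀) (μ ⊗ₘ mixture κ (p v)) ≤
      ∫⁻ z, ENNReal.ofReal (3 * (∑ x, (p v x - p₀ x) * f x z) ^ 2) ∂M := by
    intro v
    have := isMarkovKernel_mixture κ hp₀
    have := isMarkovKernel_mixture κ (hp v)
    have i1 : IsFiniteMeasure (M.withDensity fun z => ENNReal.ofReal (∑ x, p₀ x * f x z)) := by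
      rw [← hmix _ hp₀]; infer_instance
    have i2 : IsFiniteMeasure (M.withDensity fun z => ENNReal.ofReal (∑ x, p v x * f x z)) := by
      rw [← hmix _ (hp v)]; infer_instance
    rw [hmix _ hp₀, hmix _ (hp v)]
    refine (klDiv_withDensity_le M (hmeas _) (hmeas _)
      (fun z => (Real.exp_pos _).le.trans (hlow _ hp₀ z))
      (fun z => (Real.exp_pos _).trans_le (hlow _ (hp v) z))).trans ?_
    refine lintegral_mono fun z => ENNReal.ofReal_le_ofReal ?_
    have h1 := hlow _ (hp v) z
    -- The chi-squared denominator is at least `exp (-1)`, hence the constant 3.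
    have h2 : (1 : ℝ) / 3 ≤ Real.exp (-1) := by
      rw [Real.exp_neg, one_div]
      exact inv_anti₀ (Real.exp_pos _) Real.exp_one_lt_three.le
    rw [div_le_iff₀ (by linarith)]
    have h3 : (∑ x, p₀ x * f x z - ∑ x, p v x * f x z) ^ 2 =
        (∑ x, (p v x - p₀ x) * f x z) ^ 2 := by
      rw [← Finset.sum_sub_distrib, ← neg_sq, ← Finset.sum_neg_distrib]
      congr 2
      ext x
      ring
    rw [h3]
    nlinarith [sq_nonneg (∑ x, (p v x - p₀ x) * f x z)]
  calc _ ≤ ∑ v, ∫⁻ z, ENNReal.ofReal (3 * (∑ x, (p v x - p₀ x) * f x z) ^ 2) ∂M :=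
        Finset.sum_le_sum fun v _ => hstep v
    _ = ∫⁻ z, ∑ v, ENNReal.ofReal (3 * (∑ x, (p v x - p₀ x) * f x z) ^ 2) ∂M := by
        rw [lintegral_finsetSum]
        exact fun v _ => (((hmeas _).pow_const 2).const_mul 3).ennreal_ofReal
    -- With the sum inside the integral, `hb` applies at each fixed `z` to `x ↦ f x z`.
    _ ≤ ∫⁻ _, ENNReal.ofReal (3 * b) ∂M := by
        refine lintegral_mono fun z => ?_
        rw [← ENNReal.ofReal_sum_of_nonneg fun v _ => by positivity, ← Finset.mul_sum]
        exact ENNReal.ofReal_le_ofReal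
          (mul_le_mul_of_nonneg_left (hb _ fun x => hf1 x z) (by norm_num))
    _ = _ := by simp [M]

end Mixture

end LocalPrivacy

namespace LocalPrivacy

open InformationTheory

/-! ### All rounds: the law of the private data -/

theorem measurable_snoc {k : ℕ} {Z : Type*} [MeasurableSpace Z] :
    Measurable fun w : (Fin k → Z) × Z => (Fin.snoc w.1 w.2 : Fin (k + 1) → Z) := by
  refine measurable_pi_iff.2 fun i => ?_
  induction i using Fin.lastCases with
  | last => simpa using measurable_snd
  | cast i => simpa [Function.comp_def] using (measurable_pi_apply i).comp measurable_fst

namespace Mechanism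

variable {n d : ℕ} {Z : Type u} [MeasurableSpace Z]

/-- The joint law of the first `k` private data when the data are i.i.d. with distribution `p`,
built from the kernels averaged over `p`. -/
noncomputable def sequentialLaw (Q : Mechanism n d Z) (p : Fin d → ℝ) :
    (k : ℕ) → k ≤ n → Measure (Fin k → Z)
  | 0, _ => Measure.dirac (fun i => i.elim0)
  | k + 1, hk =>
      ((Q.sequentialLaw p k (Nat.le_of_succ_le hk)) ⊗ₘ mixture (Q.channel ⟨k, hk⟩) p).map
          (fun w => (Fin.snoc w.1 w.2 : Fin (k + 1) → Z))

theorem isProbabilityMeasure_condLaw (Q : Mechanism n d Z) (k : ℕ) (hk : k ≤ n)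
    (x : Fin k → Fin d) : IsProbabilityMeasure (Q.condLaw k hk x) := by
  induction k with
  | zero => rw [condLaw]; infer_instance
  | succ k ih =>
    have := ih (Nat.le_of_succ_le hk) fun i => x i.castSucc
    have := Q.markov ⟨k, hk⟩
    rw [condLaw]
    exact Measure.isProbabilityMeasure_map measurable_snoc.aemeasurable

theorem isProbabilityMeasure_sequentialLaw (Q : Mechanism n d Z) {p : Fin d → ℝ}
    (hp : p ∈ stdSimplex ℝ (Fin d)) (k : ℕ) (hk : k ≤ n) :
    IsProbabilityMeasure (Q.sequentialLaw p k hk) := by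
  induction k with
  | zero => rw [sequentialLaw]; infer_instance
  | succ k ih =>
    have := ih (Nat.le_of_succ_le hk)
    have := Q.markov ⟨k, hk⟩
    have := isMarkovKernel_mixture (Q.channel ⟨k, hk⟩) hp
    rw [sequentialLaw]
    exact Measure.isProbabilityMeasure_map measurable_snoc.aemeasurable

/-- Each new datum is independent of the past, so averaging over it can be done inside its kernel.
This puts `law` in the form the chain rule needs. -/
theorem sequentialLaw_eq_sum (Q : Mechanism n d Z) {p : Fin d → ℝ}
    (hp : p ∈ stdSimplex ℝ (Fin d)) (k : ℕ) (hk : k ≤ n) :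
    Q.sequentialLaw p k hk =
      ∑ x : Fin k → Fin d, ENNReal.ofReal (∏ i, p (x i)) • Q.condLaw k hk x := by
  induction k with
  | zero => simp [sequentialLaw, condLaw]
  | succ k ih =>
    have hk' := Nat.le_of_succ_le hk
    have := Q.markov ⟨k, hk⟩
    have := Q.isProbabilityMeasure_condLaw k hk'
    have := Q.isProbabilityMeasure_sequentialLaw hp k hk'
    rw [sequentialLaw, compProd_mixture _ _ hp]
    simp only [condLaw]
    rw [← (Fin.snocEquiv fun _ => Fin d).sum_comp, Fintype.sum_prod_type]
    ext s hs
    have hs' := measurable_snoc hs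
    rw [Measure.map_apply measurable_snoc hs]
    simp only [Measure.coe_finsetSum, Finset.sum_apply, Measure.smul_apply, smul_eq_mul,
      Measure.map_apply measurable_snoc hs, Fin.snocEquiv_apply, Fin.prod_univ_castSucc,
      Fin.snoc_castSucc, Fin.snoc_last]
    refine Finset.sum_congr rfl fun y _ => ?_
    rw [Measure.compProd_apply hs', ih hk', lintegral_finsetSum_measure, Finset.mul_sum]
    refine Finset.sum_congr rfl fun x _ => ?_
    rw [lintegral_smul_measure, Measure.compProd_apply hs', smul_eq_mul, ← mul_assoc,
      ENNReal.ofReal_mul (Finset.prod_nonneg fun i _ => hp.1 _),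
      mul_comm (ENNReal.ofReal (p y))]

theorem law_eq_sequentialLaw (Q : Mechanism n d Z) {p : Fin d → ℝ}
    (hp : p ∈ stdSimplex ℝ (Fin d)) : Q.law p = Q.sequentialLaw p n le_rfl :=
  (Q.sequentialLaw_eq_sum hp n le_rfl).symm

/-- The divergences between the laws of the private data, summed over a finite family of
alternatives. -/
theorem sum_klDiv_sequentialLaw_le (Q : Mechanism n d Z) {α : ℝ} (hα : 0 ≤ α) (hα1 : α ≤ 1)
    (hQ : Q.IsLDP α) {V : Type*} [Fintype V] {p₀ : Fin d → ℝ} (hp₀ : p₀ ∈ stdSimplex ℝ (Fin d))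
    {p : V → Fin d → ℝ} (hp : ∀ v, p v ∈ stdSimplex ℝ (Fin d)) {b : ℝ}
    (hb : ∀ f : Fin d → ℝ, (∀ x, |f x - 1| ≤ 2 * α) →
      ∑ v, (∑ x, (p v x - p₀ x) * f x) ^ 2 ≤ b) (k : ℕ) (hk : k ≤ n) :
    ∑ v, klDiv (Q.sequentialLaw p₀ k hk) (Q.sequentialLaw (p v) k hk) ≤
      k * ENNReal.ofReal (3 * b) := by
  induction k with
  | zero => simp [sequentialLaw, klDiv_self]
  | succ k ih =>
    have hk' := Nat.le_of_succ_le hk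
    have := Q.markov ⟨k, hk⟩
    have := Q.isProbabilityMeasure_sequentialLaw hp₀ k hk'
    have := isMarkovKernel_mixture (Q.channel ⟨k, hk⟩) hp₀
    -- Chain rule, then data processing under `Fin.snoc`; the second term keeps the past under `p₀`
    -- on both sides.
    calc _ ≤ ∑ v, (klDiv (Q.sequentialLaw p₀ k hk') (Q.sequentialLaw (p v) k hk') +
          klDiv (Q.sequentialLaw p₀ k hk' ⊗ₘ mixture (Q.channel ⟨k, hk⟩) p₀)
            (Q.sequentialLaw p₀ k hk' ⊗ₘ mixture (Q.channel ⟨k, hk⟩) (p v))) := by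
          refine Finset.sum_le_sum fun v _ => ?_
          have := Q.isProbabilityMeasure_sequentialLaw (hp v) k hk'
          have := isMarkovKernel_mixture (Q.channel ⟨k, hk⟩) (hp v)
          rw [← klDiv_compProd_eq_add, sequentialLaw, sequentialLaw]
          exact klDiv_map_le _ _ measurable_snoc
      _ ≤ k * ENNReal.ofReal (3 * b) + ENNReal.ofReal (3 * b) := by
          rw [Finset.sum_add_distrib]
          exact add_le_add (ih hk') (sum_klDiv_compProd_mixture_le _ _ hα hα1
            (fun x x' a s hs => hQ ⟨k, hk⟩ x x' a s hs) hp₀ hp hb)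
      _ = _ := by push_cast; ring

end Mechanism

/-! ### From divergences to the testing radius -/

variable {d : ℕ}

/-- A finite family of alternatives that no locally private mechanism can tell from `p₀` on
average bounds the minimax risk from below. -/
theorem lt_minimaxRisk {γ : ℝ} (hγ₀ : 0 < γ) (hγ₁ : γ < 1) {n : ℕ} {α : ℝ} (hα : 0 ≤ α)
    (hα1 : α ≤ 1) {p₀ : Fin d → ℝ} (hp₀ : p₀ ∈ stdSimplex ℝ (Fin d)) {δ : ℝ} {r : ℝ≥0∞}
    {V : Type*} [Fintype V] [Nonempty V] {p : V → Fin d → ℝ} (hp : ∀ v, p v ∈ alternative p₀ δ r)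
    {b : ℝ} (hb : ∀ f : Fin d → ℝ, (∀ x, |f x - 1| ≤ 2 * α) →
      ∑ v, (∑ x, (p v x - p₀ x) * f x) ^ 2 ≤ Fintype.card V * b)
    (hnb : 3 * (n * b) ≤ ((1 - γ) / 3) ^ 2) :
    ENNReal.ofReal γ < minimaxRisk.{u} n α p₀ δ r := by
  -- The average divergence is at most `t ^ 2`, so the average loss `t + klDiv / t` is at most `2 *
  -- t`, and `1 - 2 * t = γ + t`.
  set t := (1 - γ) / 3
  have ht : 0 < t := by simp only [t]; linarith
  refine lt_of_lt_of_le (b := ENNReal.ofReal (1 - 2 * t)) ?_ ?_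
  · rw [ENNReal.ofReal_lt_ofReal_iff] <;> simp only [t] <;> linarith
  rw [minimaxRisk]
  refine le_iInf fun Z => le_iInf fun _ => le_iInf fun Q => le_iInf fun hQ => ?_
  rw [mechanismRisk]
  refine le_iInf fun φ => le_iInf fun hφ => ?_
  set S := ⨆ q ∈ alternative p₀ δ r, ((∫⁻ z, φ z ∂(Q.law p₀)) + ∫⁻ z, (1 - φ z) ∂(Q.law q))
  have hS : ∀ v, (1 : ℝ≥0∞) ≤ S + (ENNReal.ofReal t +
      klDiv (Q.sequentialLaw p₀ n le_rfl) (Q.sequentialLaw (p v) n le_rfl) /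
        ENNReal.ofReal t) := by
    intro v
    have := Q.isProbabilityMeasure_sequentialLaw hp₀ n le_rfl
    have := Q.isProbabilityMeasure_sequentialLaw (hp v).1 n le_rfl
    refine (one_le_test_errors_add_klDiv (Q.sequentialLaw p₀ n le_rfl)
      (Q.sequentialLaw (p v) n le_rfl) hφ.1 hφ.2 ht).trans ?_
    gcongr
    rw [← Q.law_eq_sequentialLaw hp₀, ← Q.law_eq_sequentialLaw (hp v).1]
    exact le_iSup₂ (f := fun q (_ : q ∈ alternative p₀ δ r) =>
      ((∫⁻ z, φ z ∂(Q.law p₀)) + ∫⁻ z, (1 - φ z) ∂(Q.law q))) (p v) (hp v)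
  have hkl := Q.sum_klDiv_sequentialLaw_le hα hα1 hQ hp₀ (fun v => (hp v).1) hb n le_rfl
  have hcard : (0 : ℝ) < Fintype.card V := by exact_mod_cast Fintype.card_pos
  have hsum : (Fintype.card V : ℝ≥0∞) ≤ Fintype.card V * (S + (ENNReal.ofReal t +
      ENNReal.ofReal t)) := by
    calc (Fintype.card V : ℝ≥0∞) = ∑ _v : V, 1 := by simp
      _ ≤ ∑ v, (S + (ENNReal.ofReal t +
          klDiv (Q.sequentialLaw p₀ n le_rfl) (Q.sequentialLaw (p v) n le_rfl) /
            ENNReal.ofReal t)) := Finset.sum_le_sum fun v _ => hS v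
      _ = Fintype.card V * S + (Fintype.card V * ENNReal.ofReal t +
          (∑ v, klDiv (Q.sequentialLaw p₀ n le_rfl) (Q.sequentialLaw (p v) n le_rfl)) /
            ENNReal.ofReal t) := by
          simp only [Finset.sum_add_distrib, Finset.sum_const, Finset.card_univ, nsmul_eq_mul,
            div_eq_mul_inv, Finset.sum_mul]
      _ ≤ Fintype.card V * S + (Fintype.card V * ENNReal.ofReal t +
          Fintype.card V * ENNReal.ofReal t) := by
          gcongr
          refine ENNReal.div_le_of_le_mul (hkl.trans ?_)
          rw [← ENNReal.ofReal_natCast, ← ENNReal.ofReal_natCast,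
            ← ENNReal.ofReal_mul (by positivity), ← ENNReal.ofReal_mul (by positivity),
            ← ENNReal.ofReal_mul (by positivity)]
          apply ENNReal.ofReal_le_ofReal
          nlinarith
      _ = _ := by ring
  have hone : (1 : ℝ≥0∞) ≤ S + (ENNReal.ofReal t + ENNReal.ofReal t) := by
    by_contra hlt
    push Not at hlt
    have := (ENNReal.mul_lt_mul_iff_right (a := (Fintype.card V : ℝ≥0∞))
      (by exact_mod_cast Fintype.card_ne_zero) (by simp)).2 hlt
    rw [mul_one] at this
    exact absurd hsum (not_le.2 this)
  rw [← ENNReal.ofReal_add ht.le ht.le, ← two_mul] at hone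
  rw [ENNReal.ofReal_sub _ (by linarith), ENNReal.ofReal_one]
  exact tsub_le_iff_right.2 hone

/-- For `δ` large enough the alternative is empty, so that the minimax risk vanishes. -/
theorem exists_minimaxRisk_eq_zero (n : ℕ) {α : ℝ} (hα : 0 ≤ α) (p₀ : Fin d → ℝ) (r : ℝ≥0∞)
    [Fact (1 ≤ r)] : ∃ δ : ℝ, 0 < δ ∧ minimaxRisk.{u} n α p₀ δ r = 0 := by
  obtain ⟨C, hC⟩ := (isCompact_stdSimplex ℝ (Fin d)).exists_bound_of_continuousOn
    (f := fun p => WithLp.toLp r (p - p₀)) (by fun_prop)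
  refine ⟨max C 0 + 1, by positivity, ?_⟩
  have hempty : alternative p₀ (max C 0 + 1) r = ∅ := by
    ext p
    simp only [alternative, Set.mem_ofPred_eq, Set.mem_empty_iff_false, iff_false, not_and, not_le]
    intro hp
    linarith [hC p hp, le_max_left C 0]
  -- A mechanism that releases nothing is private; over an empty alternative the zero test has risk
  -- 0.
  let Q : Mechanism n d PUnit.{u + 1} :=
    ⟨fun _ _ => Kernel.const _ (Measure.dirac PUnit.unit), fun _ _ => inferInstance⟩
  have hQ : Q.IsLDP α := by
    intro i x x' z A _
    calc Q.channel i x z A = 1 * Q.channel i x' z A := by simp [Q]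
      _ ≤ _ := by gcongr; simpa using hα
  refine le_antisymm ?_ bot_le
  calc minimaxRisk.{u} n α p₀ (max C 0 + 1) r ≤ mechanismRisk Q p₀ (max C 0 + 1) r :=
        iInf_le_of_le _ (iInf_le_of_le _ (iInf_le_of_le Q (iInf_le _ hQ)))
    _ ≤ 0 := by
        refine iInf_le_of_le 0 (iInf_le_of_le ⟨measurable_zero, fun _ => zero_le⟩ ?_)
        simp [hempty]

/-- Nonemptiness of the set of admissible `δ` is essential, since `sInf ∅ = 0` in `ℝ`. -/
theorem le_testingRadius {γ : ℝ} {n : ℕ} {α : ℝ} (hα : 0 ≤ α) {p₀ : Fin d → ℝ} {r : ℝ≥0∞}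
    [Fact (1 ≤ r)] {ρ : ℝ}
    (h : ∀ δ, 0 < δ → δ < ρ → ENNReal.ofReal γ < minimaxRisk.{u} n α p₀ δ r) :
    ρ ≤ testingRadius.{u} γ n α p₀ r := by
  obtain ⟨δ, hδ, h0⟩ := exists_minimaxRisk_eq_zero.{u} n hα p₀ r
  refine le_csInf ⟨δ, hδ, by simp [h0]⟩ fun δ' hδ' => ?_
  by_contra hlt
  exact absurd hδ'.2 (not_le.2 (h δ' hδ'.1 (not_le.1 hlt)))

end LocalPrivacy

/-! ### The two families of alternatives -/

namespace LocalPrivacy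

variable {d : ℕ}

/-- Moving mass towards one point cannot be detected below the parametric rate. -/
theorem lt_minimaxRisk_of_lt_parametric {γ : ℝ} (hγ₀ : 0 < γ) (hγ₁ : γ < 1) (hd : 2 ≤ d)
    {p₀ : Fin d → ℝ} (hp₀ : p₀ ∈ stdSimplex ℝ (Fin d)) {n : ℕ} (hn : 1 ≤ n) {α : ℝ}
    (hα : 0 < α) (hα1 : α ≤ 1) {r : ℝ≥0∞} [Fact (1 ≤ r)] {δ : ℝ} (hδ : 0 < δ)
    (hδ1 : δ < (1 - γ) / 50 * min 1 (1 / √((n : ℝ) * α ^ 2))) :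
    ENNReal.ofReal γ < minimaxRisk.{u} n α p₀ δ r := by
  -- At such a `k`, moving the fraction `2 * δ` of the mass changes the coordinate by `2 * δ * (1 -
  -- p₀ k) ≥ δ`.
  obtain ⟨k, hk⟩ : ∃ k, p₀ k ≤ 1 / 2 := by
    by_contra! h
    let a : Fin d := ⟨0, by omega⟩
    let b : Fin d := ⟨1, by omega⟩
    have hab : a ≠ b := by simp [a, b]
    have : ∑ x ∈ {a, b}, p₀ x ≤ ∑ x, p₀ x :=
      Finset.sum_le_sum_of_subset_of_nonneg (Finset.subset_univ _) fun x _ _ => hp₀.1 x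
    rw [Finset.sum_pair hab, hp₀.2] at this
    linarith [h a, h b]
  have hn' : (1 : ℝ) ≤ n := by exact_mod_cast hn
  have hN : 0 < (n : ℝ) * α ^ 2 := by positivity
  have hsN := Real.sqrt_pos.2 hN
  have hδ2 : δ ≤ 1 / 50 := by
    have := mul_le_mul_of_nonneg_left (min_le_left 1 (1 / √((n : ℝ) * α ^ 2)))
      (by linarith : 0 ≤ (1 - γ) / 50)
    linarith
  have hδ3 : δ * √((n : ℝ) * α ^ 2) ≤ (1 - γ) / 50 := by
    have := mul_le_mul_of_nonneg_left (min_le_right 1 (1 / √((n : ℝ) * α ^ 2)))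
      (by linarith : 0 ≤ (1 - γ) / 50)
    rw [mul_one_div] at this
    exact (le_div_iff₀ hsN).1 (hδ1.le.trans this)
  have hδ4 : δ ^ 2 * (n * α ^ 2) ≤ ((1 - γ) / 50) ^ 2 := by
    calc δ ^ 2 * (n * α ^ 2) = (δ * √((n : ℝ) * α ^ 2)) ^ 2 := by
          rw [mul_pow, Real.sq_sqrt hN.le]
      _ ≤ _ := by gcongr
  have hsum1 : ∑ x, (Pi.single k 1 : Fin d → ℝ) x = 1 := by simp
  let q : Fin d → ℝ := fun x => p₀ x + 2 * δ * ((Pi.single k 1 : Fin d → ℝ) x - p₀ x)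
  have hsingle : ∀ x, 0 ≤ (Pi.single k 1 : Fin d → ℝ) x := fun x =>
    (Pi.single_nonneg.2 zero_le_one : (0 : Fin d → ℝ) ≤ Pi.single k 1) x
  refine lt_minimaxRisk hγ₀ hγ₁ hα.le hα1 hp₀ (V := Unit) (p := fun _ => q)
    (b := (8 * δ * α) ^ 2) (fun _ => ⟨⟨fun x => ?_, ?_⟩, ?_⟩) (fun f hf => ?_) ?_
  · have : q x = (1 - 2 * δ) * p₀ x + 2 * δ * (Pi.single k 1 : Fin d → ℝ) x := by
      simp only [q]; ring
    rw [this]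
    exact add_nonneg (mul_nonneg (by linarith) (hp₀.1 x)) (mul_nonneg (by linarith) (hsingle x))
  · simp only [q, Finset.sum_add_distrib, ← Finset.mul_sum, Finset.sum_sub_distrib, hp₀.2, hsum1]
    ring
  · refine le_trans ?_ (PiLp.norm_apply_le _ k)
    simp only [Pi.sub_apply, q, Pi.single_eq_same, Real.norm_eq_abs]
    refine le_trans ?_ (le_abs_self _)
    nlinarith
  · have h1 : ∑ x, (q x - p₀ x) * f x =
        2 * δ * ∑ x, ((Pi.single k 1 : Fin d → ℝ) x - p₀ x) * (f x - 1) := by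
      simp only [q, mul_sub, mul_one, Finset.sum_sub_distrib, hsum1, hp₀.2, add_sub_cancel_left,
        Finset.mul_sum, sub_mul, Finset.sum_sub_distrib]
      simp only [← Finset.mul_sum, mul_assoc]
      ring
    have h2 : |∑ x, ((Pi.single k 1 : Fin d → ℝ) x - p₀ x) * (f x - 1)| ≤ 4 * α := by
      calc _ ≤ ∑ x, |((Pi.single k 1 : Fin d → ℝ) x - p₀ x) * (f x - 1)| :=
            Finset.abs_sum_le_sum_abs _ _
        _ ≤ ∑ x, ((Pi.single k 1 : Fin d → ℝ) x + p₀ x) * (2 * α) := by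
            refine Finset.sum_le_sum fun x _ => ?_
            rw [abs_mul]
            gcongr
            · exact add_nonneg (hsingle x) (hp₀.1 x)
            · rw [abs_le]
              constructor <;> linarith [hsingle x, hp₀.1 x]
            · exact hf x
        _ = _ := by
            rw [← Finset.sum_mul, Finset.sum_add_distrib, hsum1, hp₀.2]
            ring
    simp only [h1, Finset.univ_unique, Finset.sum_singleton, Fintype.card_unique, Nat.cast_one,
      one_mul]
    rw [mul_pow, ← sq_abs (∑ x, _)]
    calc (2 * δ) ^ 2 * |∑ x, ((Pi.single k 1 : Fin d → ℝ) x - p₀ x) * (f x - 1)| ^ 2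
        ≤ (2 * δ) ^ 2 * (4 * α) ^ 2 := by gcongr
      _ = _ := by ring
  · nlinarith [sq_nonneg (1 - γ)]

/-- The second moment of a Rademacher sum. -/
theorem sum_sq_sum_sign_mul (m : ℕ) (a : Fin m → ℝ) :
    ∑ v : Fin m → Bool, (∑ i, (if v i then 1 else -1) * a i) ^ 2 = 2 ^ m * ∑ i, a i ^ 2 := by
  induction m with
  | zero => simp
  | succ m ih =>
    rw [← (Fin.consEquiv fun _ => Bool).sum_comp, Fintype.sum_prod_type]
    simp only [Fin.consEquiv_apply, Fin.sum_univ_succ, Fin.cons_zero, Fin.cons_succ,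
      Fintype.univ_bool, Finset.mem_singleton, Bool.true_eq_false, not_false_eq_true,
      Finset.sum_insert, Finset.sum_singleton, if_true, Bool.false_eq_true, if_false]
    -- Adding the two choices of the first sign cancels the cross terms.
    rw [← Finset.sum_add_distrib]
    have h : ∀ v : Fin m → Bool,
        (1 * a 0 + ∑ i, (if v i then 1 else -1) * a i.succ) ^ 2 +
          (-1 * a 0 + ∑ i, (if v i then 1 else -1) * a i.succ) ^ 2 =
        2 * a 0 ^ 2 + 2 * (∑ i, (if v i then 1 else -1) * a i.succ) ^ 2 := fun v => by ring
    simp only [h, Finset.sum_add_distrib, ← Finset.mul_sum, ih fun i => a i.succ]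
    simp
    ring

/-- The perturbation pattern attached to a choice of signs: the sign `v i` at `i` and `-v i` at
`m + i`, for `i < m`. -/
def signPattern {m : ℕ} (v : Fin m → Bool) (x : ℕ) : ℝ :=
  if h : x < m then (if v ⟨x, h⟩ then 1 else -1)
  else if h : x - m < m then -(if v ⟨x - m, h⟩ then 1 else -1) else 0

theorem abs_signPattern {m : ℕ} (v : Fin m → Bool) {x : ℕ} (hx : x < m + m) :
    |signPattern v x| = 1 := by
  unfold signPattern
  split_ifs <;> first | omega | simp

theorem signPattern_eq_zero {m : ℕ} (v : Fin m → Bool) {x : ℕ} (hx : m + m ≤ x) :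
    signPattern v x = 0 := by
  rw [signPattern, dif_neg (by omega), dif_neg (by omega)]

theorem sum_comp_of_eq_zero {m : ℕ} (hm : m + m ≤ d) {g : ℕ → ℝ}
    (hg : ∀ x, m + m ≤ x → g x = 0) :
    ∑ x : Fin d, g x = ∑ i : Fin m, (g i + g (m + i)) := by
  obtain ⟨e, rfl⟩ := Nat.exists_eq_add_of_le hm
  rw [Fin.sum_univ_add, Fin.sum_univ_add, Finset.sum_add_distrib]
  simp [hg, add_comm]

/-- Opposite signs at `i` and `m + i` leave only differences of `F`: constant `F` gives zero, so
mass is preserved. -/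
theorem sum_signPattern_mul {m : ℕ} (hm : m + m ≤ d) (v : Fin m → Bool) (F : ℕ → ℝ) :
    ∑ x : Fin d, signPattern v x * F x =
      ∑ i : Fin m, (if v i then 1 else -1) * (F i - F (m + i)) := by
  rw [sum_comp_of_eq_zero hm (g := fun x => signPattern v x * F x)
    fun x hx => by rw [signPattern_eq_zero v hx, zero_mul]]
  refine Finset.sum_congr rfl fun i _ => ?_
  simp only [signPattern, Fin.is_lt, dif_pos, Fin.eta, add_tsub_cancel_left,
    dif_neg (show ¬ m + (i : ℕ) < m by omega)]
  ring

/-- Random signs on the `j` most likely points cannot be detected below the nonparametric rate. -/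
theorem lt_minimaxRisk_of_lt_nonparametric {γ : ℝ} (hγ₀ : 0 < γ) (hγ₁ : γ < 1)
    {p₀ : Fin d → ℝ} (hp₀ : p₀ ∈ stdSimplex ℝ (Fin d)) (hanti : Antitone p₀) {n : ℕ}
    (hn : 1 ≤ n) {α : ℝ} (hα : 0 < α) (hα1 : α ≤ 1) (j : Fin d) (hj : 1 ≤ (j : ℕ)) {δ : ℝ}
    (hδ : 0 < δ) (hδ1 : δ ≤ (1 - γ) / 50 * (√((j : ℝ) + 1) / √((n : ℝ) * α ^ 2)))
    (hδ2 : δ ≤ p₀ j) :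
    ENNReal.ofReal γ < minimaxRisk.{u} n α p₀ δ 1 := by
  -- All perturbed points have index at most `j`, where `p₀` is at least `p₀ j`; `j ≥ 1` ensures at
  -- least one pair.
  obtain ⟨m, hm1, hm2⟩ : ∃ m : ℕ, m + m ≤ (j : ℕ) + 1 ∧ (j : ℕ) + 1 ≤ 4 * m :=
    ⟨((j : ℕ) + 1) / 2, by omega, by omega⟩
  have hmd : m + m ≤ d := by omega
  have hm1' : (m : ℝ) + m ≤ (j : ℝ) + 1 := by exact_mod_cast hm1
  have hm2' : (j : ℝ) + 1 ≤ 4 * m := by exact_mod_cast hm2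
  have hj' : (1 : ℝ) ≤ j := by exact_mod_cast hj
  have hn' : (1 : ℝ) ≤ n := by exact_mod_cast hn
  have hN : 0 < (n : ℝ) * α ^ 2 := by positivity
  set J : ℝ := (j : ℝ) + 1 with hJ
  have hJ0 : 0 < J := by positivity
  have hδ3 : δ ^ 2 * (n * α ^ 2) ≤ ((1 - γ) / 50) ^ 2 * J := by
    have h : δ * √((n : ℝ) * α ^ 2) ≤ (1 - γ) / 50 * √J := by
      rw [← mul_div_assoc] at hδ1
      exact (le_div_iff₀ (Real.sqrt_pos.2 hN)).1 hδ1
    calc δ ^ 2 * (n * α ^ 2) = (δ * √((n : ℝ) * α ^ 2)) ^ 2 := by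
          rw [mul_pow, Real.sq_sqrt hN.le]
      _ ≤ ((1 - γ) / 50 * √J) ^ 2 := by gcongr
      _ = _ := by rw [mul_pow, Real.sq_sqrt hJ0.le]
  -- The `L₁` distance is `2 * m * η ≥ J * η / 2 = δ`.
  set η := 2 * δ / J with hη
  have hη0 : 0 ≤ η := by positivity
  have hηJ : η * J = 2 * δ := div_mul_cancel₀ _ hJ0.ne'
  have hηp : η ≤ p₀ j := by
    refine le_trans ?_ hδ2
    rw [hη, div_le_iff₀ hJ0]
    nlinarith
  let q : (Fin m → Bool) → Fin d → ℝ := fun v x => p₀ x + η * signPattern v x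
  refine lt_minimaxRisk hγ₀ hγ₁ hα.le hα1 hp₀ (p := q) (b := η ^ 2 * (m * (4 * α) ^ 2))
    (fun v => ⟨⟨fun x => ?_, ?_⟩, ?_⟩) (fun f hf => ?_) ?_
  · simp only [q]
    rcases lt_or_ge (x : ℕ) (m + m) with h | h
    · have h1 : p₀ j ≤ p₀ x := hanti (Fin.le_def.2 (by omega))
      have h2 := (abs_le.1 (abs_signPattern v h).le).1
      nlinarith
    · simpa [signPattern_eq_zero v h] using hp₀.1 x
  · have := sum_signPattern_mul hmd v fun _ => 1
    simp only [mul_one, sub_self, mul_zero, Finset.sum_const_zero] at this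
    simp [q, Finset.sum_add_distrib, hp₀.2, ← Finset.mul_sum, this]
  · rw [PiLp.norm_eq_of_L1]
    have h := sum_comp_of_eq_zero hmd (g := fun x => |η * signPattern v x|)
      fun x hx => by simp [signPattern_eq_zero v hx]
    have h' : ∀ i : Fin m, |η * signPattern v i| + |η * signPattern v (m + i)| = 2 * η := by
      intro i
      rw [abs_mul, abs_mul, abs_signPattern v (by omega), abs_signPattern v (by omega),
        abs_of_nonneg hη0]
      ring
    simp only [Pi.sub_apply, q, add_sub_cancel_left, Real.norm_eq_abs, h, h', Finset.sum_const,
      Finset.card_univ, Fintype.card_fin, nsmul_eq_mul]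
    nlinarith
  · let F : ℕ → ℝ := fun x => if h : x < d then f ⟨x, h⟩ else 1
    have hF : ∀ x, |F x - 1| ≤ 2 * α := by
      intro x
      simp only [F]
      split_ifs with h
      · exact hf _
      · simp [hα.le]
    have hsum : ∀ v, ∑ x, (q v x - p₀ x) * f x =
        η * ∑ i : Fin m, (if v i then 1 else -1) * (F i - F (m + i)) := by
      intro v
      rw [← sum_signPattern_mul hmd v F, Finset.mul_sum]
      refine Finset.sum_congr rfl fun x _ => ?_
      simp [q, F, mul_assoc]
    simp only [hsum, mul_pow, ← Finset.mul_sum]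
    rw [sum_sq_sum_sign_mul]
    have hle : ∑ i : Fin m, (F i - F (m + i)) ^ 2 ≤ m * (4 * α) ^ 2 := by
      calc _ ≤ ∑ _i : Fin m, (4 * α) ^ 2 := by
            refine Finset.sum_le_sum fun i _ => sq_le_sq' ?_ ?_ <;>
              linarith [(abs_le.1 (hF i)).1, (abs_le.1 (hF i)).2, (abs_le.1 (hF (m + i))).1,
                (abs_le.1 (hF (m + i))).2]
        _ = _ := by simp
    have : (Fintype.card (Fin m → Bool) : ℝ) = 2 ^ m := by simp
    rw [this]
    calc _ ≤ η ^ 2 * (2 ^ m * (m * (4 * α) ^ 2)) := by gcongr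
      _ = _ := by ring
  · have h1 : (η ^ 2 * (m * (4 * α) ^ 2)) * n ≤ 32 * ((1 - γ) / 50) ^ 2 := by
      have h2 : η ^ 2 * (J * (n * α ^ 2)) ≤ 4 * ((1 - γ) / 50) ^ 2 := by
        have h3 : η ^ 2 * (J * (n * α ^ 2)) * J ≤ 4 * ((1 - γ) / 50) ^ 2 * J := by
          calc _ = (η * J) ^ 2 * (n * α ^ 2) := by ring
            _ = 4 * (δ ^ 2 * (n * α ^ 2)) := by rw [hηJ]; ring
            _ ≤ _ := by linarith
        exact le_of_mul_le_mul_right h3 hJ0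
      calc _ = 8 * (η ^ 2 * ((m + m) * (n * α ^ 2))) := by ring
        _ ≤ 8 * (η ^ 2 * (J * (n * α ^ 2))) := by gcongr
        _ ≤ _ := by linarith
    nlinarith [sq_nonneg (1 - γ)]

/-- The lower bound on the `L₁` testing radius given by the first `j + 1` points. -/
theorem mul_min_le_testingRadius_one {γ : ℝ} (hγ₀ : 0 < γ) (hγ₁ : γ < 1) (hd : 2 ≤ d)
    {p₀ : Fin d → ℝ} (hp₀ : p₀ ∈ stdSimplex ℝ (Fin d)) (hanti : Antitone p₀) {n : ℕ}
    (hn : 1 ≤ n) {α : ℝ} (hα : 0 < α) (hα1 : α ≤ 1) (j : Fin d) :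
    (1 - γ) / 100 * min (√((j : ℝ) + 1) / √((n : ℝ) * α ^ 2))
      (p₀ j / √(Real.log (2 * ((j : ℝ) + 1)))) ≤ testingRadius.{u} γ n α p₀ 1 := by
  refine le_testingRadius hα.le fun δ hδ hlt => ?_
  have hc : 0 ≤ (1 - γ) / 100 := by linarith
  have hA : δ < (1 - γ) / 100 * (√((j : ℝ) + 1) / √((n : ℝ) * α ^ 2)) :=
    hlt.trans_le (mul_le_mul_of_nonneg_left (min_le_left _ _) hc)
  have hB : δ < (1 - γ) / 100 * (p₀ j / √(Real.log (2 * ((j : ℝ) + 1)))) :=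
    hlt.trans_le (mul_le_mul_of_nonneg_left (min_le_right _ _) hc)
  -- Only this crude bound on the logarithm is needed; it costs a factor 2, absorbed by 100 in place
  -- of 50.
  have hl : (1 : ℝ) / 2 ≤ √(Real.log (2 * ((j : ℝ) + 1))) := by
    apply Real.le_sqrt_of_sq_le
    have h1 : Real.log 2 ≤ Real.log (2 * ((j : ℝ) + 1)) :=
      Real.log_le_log (by norm_num) (by linarith [(Nat.cast_nonneg (j : ℕ) : (0 : ℝ) ≤ (j : ℕ))])
    linarith [Real.log_two_gt_d9]
  have hB' : p₀ j / √(Real.log (2 * ((j : ℝ) + 1))) ≤ 2 * p₀ j := by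
    rw [div_le_iff₀ (by linarith)]
    nlinarith [hp₀.1 j]
  have hB'' := hB.trans_le (mul_le_mul_of_nonneg_left hB' hc)
  have hp1 : p₀ j ≤ 1 := by
    rw [← hp₀.2]
    exact Finset.single_le_sum (fun x _ => hp₀.1 x) (Finset.mem_univ j)
  have hR : 0 ≤ √((j : ℝ) + 1) / √((n : ℝ) * α ^ 2) := by positivity
  -- A single point admits no pair of signs, so `j = 0` uses the parametric family; the cap by 1
  -- comes from `p₀ j ≤ 1`.
  rcases Nat.eq_zero_or_pos (j : ℕ) with hj | hj
  · refine lt_minimaxRisk_of_lt_parametric hγ₀ hγ₁ hd hp₀ hn hα hα1 hδ ?_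
    rw [mul_min_of_nonneg _ _ (by linarith), lt_min_iff]
    simp only [hj, Nat.cast_zero, zero_add, Real.sqrt_one] at hA hR
    constructor <;> nlinarith
  · refine lt_minimaxRisk_of_lt_nonparametric hγ₀ hγ₁ hp₀ hanti hn hα hα1 j hj hδ ?_ ?_
    · nlinarith
    · nlinarith [hp₀.1 j]

end LocalPrivacy

theorem theorem5 (γ : ℝ) (hγ₀ : 0 < γ) (hγ₁ : γ < 1) :
    (∃ c₁ : ℝ, 0 < c₁ ∧ ∃ c₂ : ℝ, 0 < c₂ ∧
      ∀ (d : ℕ), 2 ≤ d → ∀ p₀ ∈ stdSimplex ℝ (Fin d), ∀ (n : ℕ), 1 ≤ n →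
        ∀ (α : ℝ), 0 < α → α ≤ 1 →
          (Antitone p₀ →
            c₁ * (⨆ j : Fin d,
              min (√((j : ℝ) + 1) / √((n : ℝ) * α ^ 2)) (p₀ j / √(Real.log (2 * ((j : ℝ) + 1)))))
              ≤ LocalPrivacy.testingRadius.{u} γ n α p₀ 1) ∧
          c₂ * min 1 (1 / √((n : ℝ) * α ^ 2)) ≤ LocalPrivacy.testingRadius.{u} γ n α p₀ 2) ∧
    (∃ c₁ : ℝ, 0 < c₁ ∧
      ∀ (d : ℕ), 2 ≤ d → ∀ p₀ ∈ stdSimplex ℝ (Fin d), Antitone p₀ → ∀ (n : ℕ), 1 ≤ n →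
        ∀ (α : ℝ), 0 < α → α ≤ 1 →
          ∀ ℓ : Fin d,
            IsGreatest {j : Fin d | √((j : ℝ) + 1) / √((n : ℝ) * α ^ 2)
              ≤ p₀ j / √(Real.log (2 * ((j : ℝ) + 1)))} ℓ →
            c₁ * (√((ℓ : ℝ) + 1) / √((n : ℝ) * α ^ 2))
              ≤ LocalPrivacy.testingRadius.{u} γ n α p₀ 1) := by
  have hc : 0 < (1 - γ) / 100 := by linarith
  have hc' : 0 < (1 - γ) / 50 := by linarith
  refine ⟨⟨(1 - γ) / 100, hc, (1 - γ) / 50, hc', fun d hd p₀ hp₀ n hn α hα hα1 =>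
    ⟨fun hanti => ?_, ?_⟩⟩, (1 - γ) / 100, hc, fun d hd p₀ hp₀ hanti n hn α hα hα1 ℓ hℓ => ?_⟩
  · have : Nonempty (Fin d) := ⟨⟨0, by omega⟩⟩
    rw [Real.mul_iSup_of_nonneg hc.le]
    exact ciSup_le fun j =>
      LocalPrivacy.mul_min_le_testingRadius_one hγ₀ hγ₁ hd hp₀ hanti hn hα hα1 j
  · exact LocalPrivacy.le_testingRadius hα.le fun δ hδ hlt =>
      LocalPrivacy.lt_minimaxRisk_of_lt_parametric hγ₀ hγ₁ hd hp₀ hn hα hα1 hδ hlt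
  · have := LocalPrivacy.mul_min_le_testingRadius_one.{u} hγ₀ hγ₁ hd hp₀ hanti hn hα hα1 ℓ
    rwa [min_eq_left hℓ.1] at this
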